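/- Let $\mathbf{k}$ be a field, let $1\le m<n$ be integers, and let $A_n=\mathbf{k}Q$ be the path algebra of the linearly oriented quiver $Q=(1\to 2\to\cdots\to n)$. Let $\mathsf{mod}\,A_n$ be the category of finitely generated right $A_n$-modules. For $1\le i\le j\le n$ let $M_{[i,j]}$ be the interval module given by the representation of $Q$ with $\mathbf{k}$ at each vertex $a$ with $i\le a\le j$, zero at all other vertices, and identity maps along the arrows between vertices of $[i,j]$; in particular $M_{[i,i]}=S(i)$ is the simple module at $i$. For $2\le i\le j\le n$ let $f^+_{[i,j]}\colon M_{[i,j]}\to M_{[i-1,j]}$ be the inclusion. Put $$T_m=\Big(\bigoplus_{1\le j\le m}M_{[1,j]}\Big)\oplus\Big(\bigoplus_{1\le i\le n}S(i)\Big).$$ A morphism $f\colon X\to Y$ in $\mathsf{mod}\,A_n$ is called a $T_m$-coghost if $g\circ f=0$ for every $T'\in\operatorname{add}T_m$ and every morphism $g\colon Y\to T'$, where $\operatorname{add}T_m$ consists of the direct summands of finite direct sums of copies of $T_m$. It is called irreducible if it is neither a split monomorphism nor a split epimorphism and, whenever $f=g\circ h$, either $h$ is a split monomorphism or $g$ is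 a split epimorphism. Then the morphisms $f^+_{[i,n-t]}$ with $m+1\le i\le n$ and $0\le t\le n-i$ are monomorphisms, and up to isomorphism they are exactly the irreducible $T_m$-coghosts in $\mathsf{mod}\,A_n$: a morphism $f\colon X\to Y$ of $\mathsf{mod}\,A_n$ is an irreducible $T_m$-coghost if and only if there are such $i$ and $t$ and isomorphisms $\alpha\colon X\to M_{[i,n-t]}$, $\beta\colon Y\to M_{[i-1,n-t]}$ with $\beta\circ f=f^+_{[i,n-t]}\circ\alpha$. -/

import Mathlib

open CategoryTheory

universe u

noncomputable section

/-! ### The path algebra of a quiver with finitely many vertices -/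

section PathAlgebra

variable (k : Type u) [Field k] (V : Type) [Quiver.{0} V]

/-- The path algebra `kQ`. Its elements are the finite `k`-linear combinations of paths of `Q`,
sorted by source and target: `x a b` is the part of `x` supported on the paths from `a` to `b`.
(For finitely many vertices this is the vector space with basis all paths.) -/
def PathAlgebra : Type u := ∀ a b : V, Quiver.Path a b →₀ k

namespace PathAlgebra

instance : AddCommGroup (PathAlgebra k V) :=
  inferInstanceAs (AddCommGroup (∀ a b : V, Quiver.Path a b →₀ k))

instance : Module k (PathAlgebra k V) :=
  inferInstanceAs (Module k (∀ a b : V, Quiver.Path a b →₀ k))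

variable {k V}

/-- The bilinear extension of the concatenation of composable paths: first `p`, then `q`. -/
def concat {a b c : V} (x : Quiver.Path a b →₀ k) (y : Quiver.Path b c →₀ k) :
    Quiver.Path a c →₀ k :=
  x.sum fun p r => y.sum fun q s => Finsupp.single (p.comp q) (r * s)

lemma concat_eq_comp {a b c : V} (x : Quiver.Path a b →₀ k) (y : Quiver.Path b c →₀ k) :
    concat x y = CategoryStruct.comp (obj := Free k (Paths V)) (X := a) (Y := b) (Z := c) x y :=
  rfl

lemma concat_assoc {a b c d : V} (x : Quiver.Path a b →₀ k) (y : Quiver.Path b c →₀ k)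
    (z : Quiver.Path c d →₀ k) : concat (concat x y) z = concat x (concat y z) :=
  Category.assoc (obj := Free k (Paths V)) (W := a) (X := b) (Y := c) (Z := d) x y z

lemma concat_add {a b c : V} (x : Quiver.Path a b →₀ k) (y z : Quiver.Path b c →₀ k) :
    concat x (y + z) = concat x y + concat x z :=
  Preadditive.comp_add (C := Free k (Paths V)) a b c x y z

lemma add_concat {a b c : V} (x y : Quiver.Path a b →₀ k) (z : Quiver.Path b c →₀ k) :
    concat (x + y) z = concat x z + concat y z :=
  Preadditive.add_comp (C := Free k (Paths V)) a b c x y z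

lemma smul_concat {a b c : V} (r : k) (x : Quiver.Path a b →₀ k) (y : Quiver.Path b c →₀ k) :
    concat (r • x) y = r • concat x y :=
  Linear.smul_comp (C := Free k (Paths V)) a b c r x y

lemma concat_smul {a b c : V} (r : k) (x : Quiver.Path a b →₀ k) (y : Quiver.Path b c →₀ k) :
    concat x (r • y) = r • concat x y :=
  Linear.comp_smul (C := Free k (Paths V)) a b c x r y

lemma nil_concat {a b : V} (x : Quiver.Path a b →₀ k) :
    concat (Finsupp.single Quiver.Path.nil 1) x = x :=
  Category.id_comp (obj := Free k (Paths V)) (X := a) (Y := b) x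

lemma concat_nil {a b : V} (x : Quiver.Path a b →₀ k) :
    concat x (Finsupp.single Quiver.Path.nil 1) = x :=
  Category.comp_id (obj := Free k (Paths V)) (X := a) (Y := b) x

lemma concat_zero {a b c : V} (x : Quiver.Path a b →₀ k) :
    concat x (0 : Quiver.Path b c →₀ k) = 0 := by
  simp [concat]

lemma zero_concat {a b c : V} (x : Quiver.Path b c →₀ k) :
    concat (0 : Quiver.Path a b →₀ k) x = 0 := by
  simp [concat]

/-- `concat` as a bilinear map. -/
def concatHom (a b c : V) :
    (Quiver.Path a b →₀ k) →ₗ[k] (Quiver.Path b c →₀ k) →ₗ[k] (Quiver.Path a c →₀ k) :=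
  LinearMap.mk₂ k concat add_concat smul_concat concat_add concat_smul

@[simp] lemma concatHom_apply {a b c : V} (x : Quiver.Path a b →₀ k)
    (y : Quiver.Path b c →₀ k) : concatHom a b c x y = concat x y := rfl

lemma add_apply (x y : PathAlgebra k V) (a b : V) : (x + y) a b = x a b + y a b := rfl

lemma zero_apply (a b : V) : (0 : PathAlgebra k V) a b = 0 := rfl

lemma smul_apply (r : k) (x : PathAlgebra k V) (a b : V) : (r • x) a b = r • x a b := rfl

/-- The product of two paths is their concatenation if they are composable, and `0` otherwise. -/
instance [Fintype V] : Mul (PathAlgebra k V) := ⟨fun x y a c => ∑ b : V, concat (x a b) (y b c)⟩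

/-- The unit is the sum of the paths of length zero. -/
instance [DecidableEq V] : One (PathAlgebra k V) :=
  ⟨fun a => Pi.single (M := fun b => Quiver.Path a b →₀ k) a
    (Finsupp.single Quiver.Path.nil 1)⟩

lemma mul_apply [Fintype V] (x y : PathAlgebra k V) (a c : V) :
    (x * y) a c = ∑ b : V, concat (x a b) (y b c) := rfl

lemma one_apply_self [DecidableEq V] (a : V) :
    (1 : PathAlgebra k V) a a = Finsupp.single Quiver.Path.nil 1 :=
  Pi.single_eq_same (M := fun b => Quiver.Path a b →₀ k) a _

lemma one_apply_ne [DecidableEq V] {a b : V} (h : b ≠ a) : (1 : PathAlgebra k V) a b = 0 :=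
  Pi.single_eq_of_ne (M := fun b => Quiver.Path a b →₀ k) h _

instance [Fintype V] [DecidableEq V] : Ring (PathAlgebra k V) :=
  { (inferInstance : AddCommGroup (PathAlgebra k V)) with
    mul := (· * ·)
    one := 1
    left_distrib := fun x y z => by
      funext a c
      simp only [add_apply, mul_apply, concat_add, Finset.sum_add_distrib]
    right_distrib := fun x y z => by
      funext a c
      simp only [add_apply, mul_apply, add_concat, Finset.sum_add_distrib]
    zero_mul := fun x => by
      funext a c
      simp only [zero_apply, mul_apply, zero_concat, Finset.sum_const_zero]
    mul_zero := fun x => by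
      funext a c
      simp only [zero_apply, mul_apply, concat_zero, Finset.sum_const_zero]
    mul_assoc := fun x y z => by
      funext a d
      simp only [mul_apply, ← concatHom_apply, map_sum, LinearMap.sum_apply]
      rw [Finset.sum_comm]
      simp only [concatHom_apply, concat_assoc]
    one_mul := fun x => by
      funext a c
      rw [mul_apply, Finset.sum_eq_single a, one_apply_self, nil_concat]
      · intro b _ hb
        rw [one_apply_ne hb, zero_concat]
      · simp
    mul_one := fun x => by
      funext a c
      rw [mul_apply, Finset.sum_eq_single c, one_apply_self, concat_nil]
      · intro b _ hb
        rw [one_apply_ne hb.symm, concat_zero]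
      · simp
    zsmul := fun m x => m • x
    nsmul := fun m x => m • x }

instance [Fintype V] [DecidableEq V] : Algebra k (PathAlgebra k V) :=
  Algebra.ofModule
    (fun r x y => by
      funext a c
      simp only [smul_apply, mul_apply, smul_concat, Finset.smul_sum])
    (fun r x y => by
      funext a c
      simp only [smul_apply, mul_apply, concat_smul, Finset.smul_sum])

end PathAlgebra

end PathAlgebra

/-! ### The linearly oriented quiver `1 → 2 → ⋯ → n` and its interval modules -/

/-- The vertices `1, …, n`. -/
@[ext] structure AVertex (n : ℕ) : Type where
  idx : ℕ
  one_le : 1 ≤ idx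
  le_n : idx ≤ n

instance (n : ℕ) : DecidableEq (AVertex n) := fun a b =>
  decidable_of_iff (a.idx = b.idx) AVertex.ext_iff.symm

instance (n : ℕ) : Fintype (AVertex n) :=
  Fintype.ofEquiv {a : ℕ // a ∈ Finset.Icc 1 n}
    { toFun := fun a => ⟨a.1, (Finset.mem_Icc.1 a.2).1, (Finset.mem_Icc.1 a.2).2⟩
      invFun := fun a => ⟨a.idx, Finset.mem_Icc.2 ⟨a.one_le, a.le_n⟩⟩
      left_inv := fun _ => rfl
      right_inv := fun _ => rfl }

/-- There is exactly one arrow `a → a + 1` for every `1 ≤ a < n`, and no other arrow. -/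
instance (n : ℕ) : Quiver.{0} (AVertex n) := ⟨fun a b => PLift (a.idx + 1 = b.idx)⟩

lemma AVertex.le_of_path {n : ℕ} {a b : AVertex n} (p : Quiver.Path a b) : a.idx ≤ b.idx := by
  induction p with
  | nil => exact le_rfl
  | cons _ e ih => have := e.down; omega

/-- The path algebra of `1 → 2 → ⋯ → n` over `k`. -/
abbrev AlgA (k : Type u) [Field k] (n : ℕ) : Type u := PathAlgebra k (AVertex n)

/-- The category of finitely generated right modules over the path algebra of `1 → ⋯ → n`. -/
abbrev ModA (k : Type u) [Field k] (n : ℕ) : Type (u + 1) := FGModuleCat.{u} (AlgA k n)ᵐᵒᵖ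

/-- The sum of the coefficients of a linear combination of paths. -/
def coeffSum {k : Type u} [Field k] {n : ℕ} {a b : AVertex n} :
    (Quiver.Path a b →₀ k) →ₗ[k] k :=
  Finsupp.lsum k fun _ => LinearMap.id

lemma coeffSum_single {k : Type u} [Field k] {n : ℕ} {a b : AVertex n} (p : Quiver.Path a b)
    (r : k) : coeffSum (Finsupp.single p r) = r := by
  simp [coeffSum]

lemma coeffSum_concat {k : Type u} [Field k] {n : ℕ} {a b c : AVertex n}
    (x : Quiver.Path a b →₀ k) (y : Quiver.Path b c →₀ k) :
    coeffSum (PathAlgebra.concat x y) = coeffSum x * coeffSum y := by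
  induction x using Finsupp.induction_linear with
  | zero => simp [PathAlgebra.zero_concat]
  | add f g hf hg => rw [PathAlgebra.add_concat, map_add, map_add, hf, hg, add_mul]
  | single p r =>
    induction y using Finsupp.induction_linear with
    | zero => simp [PathAlgebra.concat_zero]
    | add f g hf hg => rw [PathAlgebra.concat_add, map_add, map_add, hf, hg, mul_add]
    | single q s =>
      rw [PathAlgebra.concat, Finsupp.sum_single_index, Finsupp.sum_single_index]
      · simp only [coeffSum_single]
      · rw [mul_zero, Finsupp.single_zero]
      · simp

lemma coeffSum_eq_zero {k : Type u} [Field k] {n : ℕ} {a b : AVertex n}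
    (x : Quiver.Path a b →₀ k) (h : b.idx < a.idx) : coeffSum x = 0 := by
  have : IsEmpty (Quiver.Path a b) := ⟨fun p => absurd (AVertex.le_of_path p) (by omega)⟩
  rw [Subsingleton.elim x 0, map_zero]

/-- The vertices `a` with `i ≤ a ≤ j`. -/
abbrev AInterval (n i j : ℕ) : Type := {a : AVertex n // i ≤ a.idx ∧ a.idx ≤ j}

/-- The underlying vector space of `M_[i,j]`: one copy of `k` at each vertex `a` with
`i ≤ a ≤ j`, and `0` at the other vertices. -/
def IntervalModule (k : Type u) [Field k] (n i j : ℕ) : Type u := AInterval n i j → k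

namespace IntervalModule

variable {k : Type u} [Field k] {n i j : ℕ}

instance : AddCommGroup (IntervalModule k n i j) :=
  inferInstanceAs (AddCommGroup (AInterval n i j → k))

instance : Module k (IntervalModule k n i j) :=
  inferInstanceAs (Module k (AInterval n i j → k))

instance : Module.Finite k (IntervalModule k n i j) :=
  inferInstanceAs (Module.Finite k (AInterval n i j → k))

/-- The right action of the path algebra: a path from `a` to `c` carries the copy of `k` at `a`
identically to the copy of `k` at `c` if both `a` and `c` lie in the interval, and every other
path acts as zero. -/
instance : SMul (AlgA k n)ᵐᵒᵖ (IntervalModule k n i j) :=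
  ⟨fun x v c => ∑ a : AInterval n i j, coeffSum (x.unop a.1 c.1) * v a⟩

lemma smul_apply (x : (AlgA k n)ᵐᵒᵖ) (v : IntervalModule k n i j) (c : AInterval n i j) :
    (x • v) c = ∑ a : AInterval n i j, coeffSum (x.unop a.1 c.1) * v a := rfl

lemma add_apply (v w : IntervalModule k n i j) (c : AInterval n i j) :
    (v + w) c = v c + w c := rfl

lemma zero_apply (c : AInterval n i j) : (0 : IntervalModule k n i j) c = 0 := rfl

lemma smulk_apply (r : k) (v : IntervalModule k n i j) (c : AInterval n i j) :
    (r • v) c = r * v c := rfl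

lemma sum_interval (F : AVertex n → k) (hF : ∀ b, ¬ (i ≤ b.idx ∧ b.idx ≤ j) → F b = 0) :
    ∑ b : AVertex n, F b = ∑ b : AInterval n i j, F b.1 := by
  classical
  rw [← Finset.sum_subtype (Finset.univ.filter fun b : AVertex n => i ≤ b.idx ∧ b.idx ≤ j)
    (by simp) F]
  refine (Finset.sum_subset (Finset.subset_univ _) fun b _ hb => hF b ?_).symm
  simpa using hb

lemma coeffSum_mul (x y : AlgA k n) (a c : AInterval n i j) :
    coeffSum ((x * y) a.1 c.1) =
      ∑ b : AInterval n i j, coeffSum (x a.1 b.1) * coeffSum (y b.1 c.1) := by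
  rw [PathAlgebra.mul_apply, map_sum]
  simp only [coeffSum_concat]
  refine sum_interval (fun b => coeffSum (x a.1 b) * coeffSum (y b c.1)) fun b hb => ?_
  obtain ⟨a, ha1, ha2⟩ := a
  obtain ⟨c, hc1, hc2⟩ := c
  by_cases h : b.idx < a.idx
  · simp only [coeffSum_eq_zero _ h, zero_mul]
  · have h' : c.idx < b.idx := by omega
    simp only [coeffSum_eq_zero _ h', mul_zero]

instance : Module (AlgA k n)ᵐᵒᵖ (IntervalModule k n i j) where
  one_smul v := by
    funext c
    rw [smul_apply, Finset.sum_eq_single c]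
    · rw [MulOpposite.unop_one, PathAlgebra.one_apply_self, coeffSum_single, one_mul]
    · intro b _ hb
      rw [MulOpposite.unop_one, PathAlgebra.one_apply_ne, map_zero, zero_mul]
      exact fun h => hb (Subtype.ext h.symm)
    · simp
  mul_smul x y v := by
    funext c
    simp only [smul_apply, MulOpposite.unop_mul, coeffSum_mul, Finset.sum_mul, Finset.mul_sum]
    rw [Finset.sum_comm]
    refine Finset.sum_congr rfl fun b _ => Finset.sum_congr rfl fun a _ => ?_
    ring
  smul_zero x := by
    funext c
    simp only [smul_apply, zero_apply, mul_zero, Finset.sum_const_zero]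
  smul_add x v w := by
    funext c
    simp only [smul_apply, add_apply, mul_add, Finset.sum_add_distrib]
  add_smul x y v := by
    funext c
    simp only [smul_apply, add_apply, MulOpposite.unop_add, PathAlgebra.add_apply, map_add,
      add_mul, Finset.sum_add_distrib]
  zero_smul v := by
    funext c
    simp only [smul_apply, zero_apply, MulOpposite.unop_zero, PathAlgebra.zero_apply, map_zero,
      zero_mul, Finset.sum_const_zero]

instance : IsScalarTower k (AlgA k n)ᵐᵒᵖ (IntervalModule k n i j) where
  smul_assoc r x v := by
    funext c
    simp only [smul_apply, smulk_apply, MulOpposite.unop_smul, PathAlgebra.smul_apply, map_smul,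
      smul_eq_mul, Finset.mul_sum, mul_assoc]

instance : Module.Finite (AlgA k n)ᵐᵒᵖ (IntervalModule k n i j) :=
  Module.Finite.of_restrictScalars_finite k (AlgA k n)ᵐᵒᵖ (IntervalModule k n i j)

/-- Extension by zero of an element of `M_[i,j]` to an element of `M_[i',j]`. -/
def zeroExtend (i' : ℕ) (v : IntervalModule k n i j) : IntervalModule k n i' j :=
  fun c => if hc : i ≤ c.1.idx then v ⟨c.1, hc, c.2.2⟩ else 0

lemma zeroExtend_apply (i' : ℕ) (v : IntervalModule k n i j) (c : AInterval n i' j) :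
    zeroExtend i' v c = if hc : i ≤ c.1.idx then v ⟨c.1, hc, c.2.2⟩ else 0 := rfl

/-- For `i' ≤ i`, the inclusion of `M_[i,j]` into `M_[i',j]` (extension by zero). -/
def inclusion (k : Type u) [Field k] (n : ℕ) {i' i : ℕ} (h : i' ≤ i) (j : ℕ) :
    IntervalModule k n i j →ₗ[(AlgA k n)ᵐᵒᵖ] IntervalModule k n i' j where
  toFun := zeroExtend i'
  map_add' v w := by
    funext c
    simp only [add_apply, zeroExtend_apply]
    by_cases hc : i ≤ c.1.idx
    · simp only [hc, dite_true]
    · simp only [hc, dite_false, add_zero]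
  map_smul' x v := by
    funext c
    simp only [smul_apply, RingHom.id_apply, zeroExtend_apply]
    by_cases hc : i ≤ c.1.idx
    · simp only [hc, dite_true]
      let F : AVertex n → k := fun a =>
        coeffSum (x.unop a c.1) * if ha : i ≤ a.idx ∧ a.idx ≤ j then v ⟨a, ha⟩ else 0
      have h1 := sum_interval (i := i) (j := j) F (fun b hb => by simp only [F, dif_neg hb, mul_zero])
      have h2 := sum_interval (i := i') (j := j) F (fun b hb => by
        have hb' : ¬ (i ≤ b.idx ∧ b.idx ≤ j) := fun hh => hb ⟨h.trans hh.1, hh.2⟩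
        simp only [F, dif_neg hb', mul_zero])
      have h3 := h1.symm.trans h2
      refine Eq.trans (Finset.sum_congr rfl fun a _ => ?_)
        (h3.trans (Finset.sum_congr rfl fun a _ => ?_))
      · simp only [F, dif_pos a.2]
      · simp only [F, a.2.2, and_true]
    · simp only [hc, dite_false]
      refine (Finset.sum_eq_zero fun a _ => ?_).symm
      by_cases ha : i ≤ a.1.idx
      · rw [coeffSum_eq_zero _ (by omega), zero_mul]
      · simp only [ha, dite_false, mul_zero]

end IntervalModule

/-- The module `M_[i,j]` as an object of the module category. -/
def intervalObj (k : Type u) [Field k] (n i j : ℕ) : ModA k n :=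
  FGModuleCat.of (AlgA k n)ᵐᵒᵖ (IntervalModule k n i j)

/-- The morphism `f⁺_[i,j] : M_[i,j] ⟶ M_[i-1,j]` (meant for `2 ≤ i ≤ j ≤ n`), which is the
inclusion. -/
def fPlus (k : Type u) [Field k] (n i j : ℕ) : intervalObj k n i j ⟶ intervalObj k n (i - 1) j :=
  FGModuleCat.ofHom (IntervalModule.inclusion k n (Nat.sub_le i 1) j)

/-- The module `T_m = (⨁_{1 ≤ j ≤ m} M_[1,j]) ⊕ (⨁_{1 ≤ i ≤ n} M_[i,i])`. -/
def Tm (k : Type u) [Field k] (n m : ℕ) : ModA k n :=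
  FGModuleCat.of (AlgA k n)ᵐᵒᵖ
    ((∀ j : Finset.Icc 1 m, IntervalModule k n 1 j) ×
      (∀ i : Finset.Icc 1 n, IntervalModule k n i i))

/-! ### Coghosts and irreducible morphisms -/

section Category

universe v w

variable {C : Type w} [Category.{v} C]

/-- `T'` lies in `add T`: it is a direct summand of a finite direct sum of copies of `T`. -/
def InAdd [Preadditive C] (T T' : C) : Prop :=
  ∃ (r : ℕ) (B : Limits.Bicone fun _ : Fin r => T),
    Nonempty B.IsBilimit ∧ Nonempty (Retract T' B.pt)

/-- `f : A ⟶ Y` is a `T`-coghost: `Hom(f, T')` is zero for every `T'` in `add T`. -/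
def IsCoghost [Preadditive C] (T : C) {A Y : C} (f : A ⟶ Y) : Prop :=
  ∀ T' : C, InAdd T T' → ∀ g : Y ⟶ T', f ≫ g = 0

/-- `f` is irreducible: it is neither a split monomorphism nor a split epimorphism, and in every
factorization of `f` the first factor is a split monomorphism or the second one is a split
epimorphism. -/
def IsIrreducibleMor {X Y : C} (f : X ⟶ Y) : Prop :=
  ¬ IsSplitMono f ∧ ¬ IsSplitEpi f ∧
    ∀ (W : C) (h : X ⟶ W) (g : W ⟶ Y), h ≫ g = f → IsSplitMono h ∨ IsSplitEpi g

end Category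

end

/-! There is at most one path between two vertices, so the path algebra has matrix units `pathUnit k
a b`, and a right module is a vector space with compatible operators `pathOp k a b`. An element
killed by the right operators gives a map out of an interval module (`ofElement`); a suitable linear
functional gives a map into one (`ofFunctional`). Every splitting below is built from these two
constructions.

The inclusion of M_[a+1,b] into M_[a,b] is irreducible by a dichotomy (`inclusion_factorization`):
given a factorization through W, the image in W of the last basis vector either is reached by the
path from a to b, which yields a section of the second factor, or is separated from the image of
that path by a functional, which yields a retraction of the first.

Conversely, let f : X → Y be an irreducible coghost. The simple summands of T_m force the image of f
into the radical of Y. If p is a projection of Y onto an interval summand M_[a,b], then p ∘ f passes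
through the radical M_[a+1,b]. Exchanging that summand for its radical factors f through M_[a+1,b] ⊕
Y, and irreducibility together with a Nakayama argument makes X → M_[a+1,b] an isomorphism
(`exists_equiv`). A second summand of Y would have the same endpoints; a suitable combination of the
two projections would then still be split but kill f, which is impossible. So f is an inclusion
(`exists_equiv_inclusion`). The summands M_[1,j] decide which a occur: M_[1,a+1] detects the
inclusion, whereas intervals ending at or before a do not. -/

noncomputable section

/-! ### The path algebra of `1 → ⋯ → n` as an algebra of triangular matrices -/

namespace AVertex

variable {n : ℕ}

instance (a b : AVertex n) : Subsingleton (Quiver.Path a b) := by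
  refine ⟨fun p => ?_⟩
  induction p with
  | nil =>
    intro q
    cases q with
    | nil => rfl
    | cons q e => have := le_of_path q; have := e.down; omega
  | cons p e ih =>
    intro q
    cases q with
    | nil => have := le_of_path p; have := e.down; omega
    | cons q e' =>
      have h := AVertex.ext (Nat.succ_injective (e.down.trans e'.down.symm))
      subst h
      rw [ih q, show e = e' from PLift.down_injective (Subsingleton.elim _ _)]

lemma nonempty_path {a b : AVertex n} (h : a.idx ≤ b.idx) : Nonempty (Quiver.Path a b) := by
  obtain ⟨d, hd⟩ := Nat.exists_eq_add_of_le h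
  induction d generalizing b with
  | zero =>
    obtain rfl : a = b := AVertex.ext hd.symm
    exact ⟨.nil⟩
  | succ d ih =>
    have := a.one_le
    have := b.le_n
    obtain ⟨p⟩ := ih (b := ⟨a.idx + d, by omega, by omega⟩) (by simp) rfl
    exact ⟨p.cons ⟨hd.symm⟩⟩

end AVertex

namespace PathAlgebra

variable {k : Type u} [Field k] {n : ℕ}

/-- With at most one path from a to b, the coefficient sum is that path's coefficient. Elements of
the algebra may therefore be compared entrywise, as triangular matrices. -/
lemma coeffSum_injective (a b : AVertex n) :
    Function.Injective (coeffSum : (Quiver.Path a b →₀ k) → k) := by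
  intro x y h
  ext p
  have key : ∀ z : Quiver.Path a b →₀ k, coeffSum z = z p := fun z => by
    have hz : z = Finsupp.single p (z p) := by
      ext q
      rw [Subsingleton.elim q p, Finsupp.single_eq_same]
    rw [hz, coeffSum_single, Finsupp.single_eq_same]
  rw [← key, ← key, h]

lemma ext_coeffSum {x y : AlgA k n} (h : ∀ a b, coeffSum (x a b) = coeffSum (y a b)) : x = y :=
  funext fun a => funext fun b => coeffSum_injective a b (h a b)

lemma coeffSum_mul_apply (x y : AlgA k n) (a c : AVertex n) :
    coeffSum ((x * y) a c) = ∑ b, coeffSum (x a b) * coeffSum (y b c) := by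
  rw [mul_apply, map_sum]
  simp only [coeffSum_concat]

lemma coeffSum_sum_smul {ι : Type*} (s : Finset ι) (r : ι → k) (x : ι → AlgA k n)
    (a c : AVertex n) :
    coeffSum ((∑ i ∈ s, r i • x i) a c) = ∑ i ∈ s, r i * coeffSum (x i a c) := by
  classical
  induction s using Finset.induction_on with
  | empty => simp [zero_apply]
  | insert i s hi ih =>
    rw [Finset.sum_insert hi, Finset.sum_insert hi, add_apply, map_add, ih, smul_apply, map_smul,
      smul_eq_mul]

open Classical in
/-- The path from `a` to `b` as an element of the path algebra (zero if there is none). -/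
def pathUnit (k : Type u) [Field k] {n : ℕ} (a b : AVertex n) : AlgA k n := fun a' b' =>
  if h : (a = a' ∧ b = b') ∧ Nonempty (Quiver.Path a' b') then Finsupp.single h.2.some 1 else 0

lemma coeffSum_pathUnit {a b : AVertex n} (h : a.idx ≤ b.idx) (a' b' : AVertex n) :
    coeffSum (pathUnit k a b a' b') = if a = a' ∧ b = b' then 1 else 0 := by
  unfold pathUnit
  by_cases hab : a = a' ∧ b = b'
  · obtain ⟨rfl, rfl⟩ := hab
    rw [dif_pos ⟨⟨rfl, rfl⟩, AVertex.nonempty_path h⟩, coeffSum_single]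
    simp
  · rw [dif_neg (fun hh => hab hh.1), if_neg hab, map_zero]

/-- A matrix unit moves row b to row a. Summing over all d is harmless: for d before b the
coefficient already vanishes. -/
lemma pathUnit_mul {a b : AVertex n} (h : a.idx ≤ b.idx) (x : AlgA k n) :
    pathUnit k a b * x = ∑ d, coeffSum (x b d) • pathUnit k a d := by
  refine ext_coeffSum fun a' c' => ?_
  rw [coeffSum_mul_apply, coeffSum_sum_smul]
  simp only [coeffSum_pathUnit h]
  rw [Finset.sum_eq_single b (by grind) (by simp), Finset.sum_eq_single c']
  · by_cases hc : b.idx ≤ c'.idx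
    · rw [coeffSum_pathUnit (h.trans hc)]
      simp [mul_comm]
    · rw [coeffSum_eq_zero _ (not_le.1 hc)]
      simp
  · intro d _ hd
    by_cases hc : b.idx ≤ d.idx
    · rw [coeffSum_pathUnit (h.trans hc), if_neg (by simp [hd]), mul_zero]
    · rw [coeffSum_eq_zero _ (not_le.1 hc), zero_mul]
  · simp

lemma mul_pathUnit {b c : AVertex n} (h : b.idx ≤ c.idx) (x : AlgA k n) :
    x * pathUnit k b c = ∑ d, coeffSum (x d b) • pathUnit k d c := by
  refine ext_coeffSum fun a' c' => ?_
  rw [coeffSum_mul_apply, coeffSum_sum_smul]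
  simp only [coeffSum_pathUnit h]
  rw [Finset.sum_eq_single b (by grind) (by simp), Finset.sum_eq_single a']
  · by_cases hc : a'.idx ≤ b.idx
    · rw [coeffSum_pathUnit (hc.trans h)]
      simp
    · rw [coeffSum_eq_zero _ (not_le.1 hc)]
      simp
  · intro d _ hd
    by_cases hc : d.idx ≤ b.idx
    · rw [coeffSum_pathUnit (hc.trans h), if_neg (by simp [hd]), mul_zero]
    · rw [coeffSum_eq_zero _ (not_le.1 hc), zero_mul]
  · simp

lemma pathUnit_mul_pathUnit {a b c : AVertex n} (hab : a.idx ≤ b.idx) (hbc : b.idx ≤ c.idx) :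
    pathUnit k a b * pathUnit k b c = pathUnit k a c := by
  rw [pathUnit_mul hab, Finset.sum_eq_single c]
  · simp [coeffSum_pathUnit hbc]
  · intro d _ hd
    rw [coeffSum_pathUnit hbc, if_neg (by simp [hd.symm]), zero_smul]
  · simp

lemma sum_pathUnit : ∑ a : AVertex n, pathUnit k a a = 1 := by
  refine ext_coeffSum fun a b => ?_
  have := coeffSum_sum_smul (k := k) Finset.univ (fun _ => 1) (fun c : AVertex n => pathUnit k c c) a b
  simp only [one_smul, one_mul, coeffSum_pathUnit le_rfl] at this
  rw [this]
  by_cases hab : a = b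
  · subst hab
    simp [one_apply_self, coeffSum_single]
  · rw [one_apply_ne (Ne.symm hab), map_zero]
    exact Finset.sum_eq_zero fun c _ => if_neg (by grind)

instance : Module.Finite k (AlgA k n) :=
  inferInstanceAs (Module.Finite k (∀ a b : AVertex n, Quiver.Path a b →₀ k))

end PathAlgebra

/-! ### Paths acting on right modules -/

open MulOpposite PathAlgebra

variable {k : Type u} [Field k] {n : ℕ}

/-- The path from `a` to `b`, as an operator on right modules. -/
def pathOp (k : Type u) [Field k] {n : ℕ} (a b : AVertex n) : (AlgA k n)ᵐᵒᵖ := op (pathUnit k a b)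

section RightModule

variable {W : Type*} [AddCommGroup W] [Module (AlgA k n)ᵐᵒᵖ W]

lemma pathOp_smul_smul {a b c : AVertex n} (hab : a.idx ≤ b.idx) (hbc : b.idx ≤ c.idx) (w : W) :
    pathOp k b c • pathOp k a b • w = pathOp k a c • w := by
  rw [smul_smul, pathOp, pathOp, ← op_mul, pathUnit_mul_pathUnit hab hbc, pathOp]

lemma sum_pathOp_smul (w : W) : ∑ a : AVertex n, pathOp k a a • w = w := by
  rw [← Finset.sum_smul]
  simp only [pathOp]
  rw [← Finset.op_sum, sum_pathUnit, op_one, one_smul]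

variable [Module k W] [IsScalarTower k (AlgA k n)ᵐᵒᵖ W]

lemma smul_pathOp_smul {a b : AVertex n} (h : a.idx ≤ b.idx) (x : (AlgA k n)ᵐᵒᵖ) (w : W) :
    x • pathOp k a b • w = ∑ d, coeffSum (x.unop b d) • pathOp k a d • w := by
  rw [smul_smul, pathOp, ← op_unop x, ← op_mul, pathUnit_mul h, Finset.op_sum, Finset.sum_smul]
  simp only [op_smul, smul_assoc, pathOp, unop_op]

lemma pathOp_smul_smul_eq_sum {b c : AVertex n} (h : b.idx ≤ c.idx) (x : (AlgA k n)ᵐᵒᵖ) (w : W) :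
    pathOp k b c • x • w = ∑ d, coeffSum (x.unop d b) • pathOp k d c • w := by
  rw [smul_smul, pathOp, ← op_unop x, ← op_mul, mul_pathUnit h, Finset.op_sum, Finset.sum_smul]
  simp only [op_smul, smul_assoc, pathOp, unop_op]

end RightModule

/-! ### Maps out of and into interval modules -/

namespace IntervalModule

lemma pathOp_smul_apply {i j : ℕ} {a b : AVertex n} (h : a.idx ≤ b.idx)
    (v : IntervalModule k n i j) (c : AInterval n i j) :
    (pathOp k a b • v) c =
      if hc : b = c.1 ∧ i ≤ a.idx then v ⟨a, hc.2, by have := c.2.2; grind⟩ else 0 := by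
  rw [smul_apply]
  simp only [pathOp, unop_op, coeffSum_pathUnit h]
  by_cases hc : b = c.1 ∧ i ≤ a.idx
  · rw [dif_pos hc, Finset.sum_eq_single ⟨a, hc.2, by have := c.2.2; grind⟩]
    · simp [hc.1]
    · intro d _ hd
      rw [if_neg (fun hh => hd (Subtype.ext hh.1.symm)), zero_mul]
    · simp
  · rw [dif_neg hc]
    refine Finset.sum_eq_zero fun d _ => ?_
    rw [if_neg, zero_mul]
    rintro ⟨rfl, rfl⟩
    exact hc ⟨rfl, d.2.1⟩

lemma sum_eq_sum_interval {W : Type*} [AddCommMonoid W] {i j : ℕ} (F : AVertex n → W)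
    (hF : ∀ b, ¬ (i ≤ b.idx ∧ b.idx ≤ j) → F b = 0) :
    ∑ b : AVertex n, F b = ∑ b : AInterval n i j, F b.1 := by
  classical
  rw [← Finset.sum_subtype (Finset.univ.filter fun b : AVertex n => i ≤ b.idx ∧ b.idx ≤ j)
    (by simp) F]
  refine (Finset.sum_subset (Finset.subset_univ _) fun b _ hb => hF b ?_).symm
  simpa using hb

section Hom

variable {W : Type*} [AddCommGroup W] [Module (AlgA k n)ᵐᵒᵖ W] [Module k W]
  [IsScalarTower k (AlgA k n)ᵐᵒᵖ W]

/-- The morphism from `M_[a,j]` that sends the generator to `w • (a → a)`. -/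
def ofElement (a : AVertex n) (j : ℕ) (w : W)
    (hw : ∀ c : AVertex n, a.idx ≤ c.idx → j < c.idx → pathOp k a c • w = 0) :
    IntervalModule k n a.idx j →ₗ[(AlgA k n)ᵐᵒᵖ] W where
  toFun v := ∑ c : AInterval n a.idx j, v c • pathOp k a c.1 • w
  map_add' v v' := by simp only [add_apply, add_smul, Finset.sum_add_distrib]
  map_smul' x v := by
    simp only [smul_apply, Finset.sum_smul, RingHom.id_apply, Finset.smul_sum]
    rw [Finset.sum_comm]
    refine Finset.sum_congr rfl fun b _ => ?_
    rw [smul_comm, smul_pathOp_smul b.2.1, sum_eq_sum_interval (i := a.idx) (j := j),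
      Finset.smul_sum]
    · exact Finset.sum_congr rfl fun c _ => by rw [smul_smul, mul_comm]
    -- Outside [a, j], either c precedes b and no path exists, or c lies beyond j and `hw` kills the
    -- term.
    · intro c hc
      have := b.2.1
      by_cases hbc : c.idx < b.1.idx
      · rw [coeffSum_eq_zero _ hbc, zero_smul]
      · rw [hw c (by omega) (by omega), smul_zero]

lemma ofElement_apply (a : AVertex n) (j : ℕ) (w : W) (hw) (v : IntervalModule k n a.idx j) :
    ofElement a j w hw v = ∑ c : AInterval n a.idx j, v c • pathOp k a c.1 • w := rfl

/-- The morphism to `M_[i,b]` determined by a linear functional. -/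
def ofFunctional (i : ℕ) (b : AVertex n) (φ : W →ₗ[k] k)
    (hφ : ∀ c : AVertex n, c.idx ≤ b.idx → c.idx < i → ∀ w, φ (pathOp k c b • w) = 0) :
    W →ₗ[(AlgA k n)ᵐᵒᵖ] IntervalModule k n i b.idx where
  toFun w c := φ (pathOp k c.1 b • w)
  map_add' w w' := by
    funext c
    simp only [smul_add, map_add]
    rfl
  map_smul' x w := by
    funext c
    change φ (pathOp k c.1 b • x • w) =
      ∑ a : AInterval n i b.idx, coeffSum (x.unop a.1 c.1) * φ (pathOp k a.1 b • w)
    rw [pathOp_smul_smul_eq_sum c.2.2, map_sum]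
    simp only [map_smul, smul_eq_mul]
    refine sum_interval (fun d => coeffSum (x.unop d c.1) * φ (pathOp k d b • w)) fun d hd => ?_
    have := c.2.2
    -- A vertex d outside [i, b] either comes after c, so that no path exists, or lies before i,
    -- where `hφ` applies.
    by_cases hdc : c.1.idx < d.idx
    · rw [coeffSum_eq_zero _ hdc, zero_mul]
    · rw [hφ d (by omega) (by omega), mul_zero]

set_option linter.unusedSectionVars false in
lemma ofFunctional_apply (i : ℕ) (b : AVertex n) (φ : W →ₗ[k] k) (hφ) (w : W)
    (c : AInterval n i b.idx) : ofFunctional i b φ hφ w c = φ (pathOp k c.1 b • w) := rfl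

end Hom

end IntervalModule

/-! ### Linear maps between interval modules -/

namespace IntervalModule

/-- The generator of `M_[i,j]`, at the vertex `a = i`. -/
def gen (k : Type u) [Field k] {n : ℕ} (a : AVertex n) (j : ℕ) : IntervalModule k n a.idx j :=
  fun c => if c.1 = a then 1 else 0

lemma gen_apply_self (a : AVertex n) (j : ℕ) (h) : gen k a j ⟨a, h⟩ = 1 := if_pos rfl

lemma pathOp_self_smul_apply {i j : ℕ} (v : IntervalModule k n i j) (c : AInterval n i j) :
    (pathOp k c.1 c.1 • v) c = v c := by
  rw [pathOp_smul_apply le_rfl, dif_pos ⟨rfl, c.2.1⟩]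

lemma pathOp_smul_gen_apply {a b : AVertex n} {j : ℕ} (h : a.idx ≤ b.idx) (hb) :
    (pathOp k a b • gen k a j) ⟨b, hb⟩ = 1 := by
  rw [pathOp_smul_apply h, dif_pos ⟨rfl, le_rfl⟩, gen_apply_self]

lemma pathOp_self_smul {a : AVertex n} {j : ℕ} (v : IntervalModule k n a.idx j)
    (d : AInterval n a.idx j) :
    pathOp k d.1 d.1 • v = v d • pathOp k a d.1 • gen k a j := by
  funext c
  rw [smulk_apply, pathOp_smul_apply le_rfl, pathOp_smul_apply d.2.1]
  by_cases hc : d.1 = c.1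
  · rw [dif_pos ⟨hc, d.2.1⟩, dif_pos ⟨hc, le_rfl⟩, gen_apply_self, mul_one]
  · rw [dif_neg (fun h => hc h.1), dif_neg (fun h => hc h.1), mul_zero]

lemma pathOp_self_smul_eq_zero {i j : ℕ} (v : IntervalModule k n i j) (d : AVertex n)
    (hd : ∀ h : i ≤ d.idx ∧ d.idx ≤ j, v ⟨d, h⟩ = 0) : pathOp k d d • v = 0 := by
  funext c
  rw [pathOp_smul_apply le_rfl, zero_apply]
  split_ifs with hc
  · exact hd _
  · rfl

section Map

variable {a : AVertex n} {i j l : ℕ}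
  (θ : IntervalModule k n a.idx j →ₗ[(AlgA k n)ᵐᵒᵖ] IntervalModule k n i l)

/-- M_[a,j] is cyclic: the component of v at d is a multiple of the generator transported along the
path from a to d, so θ is determined by the image of `gen`. -/
lemma map_apply_eq_pathOp_smul (v : IntervalModule k n a.idx j) (d : AInterval n i l)
    (hd : a.idx ≤ d.1.idx ∧ d.1.idx ≤ j) :
    θ v d = v ⟨d.1, hd⟩ * (pathOp k a d.1 • θ (gen k a j)) d := by
  rw [← pathOp_self_smul_apply (θ v) d, ← map_smul, pathOp_self_smul v ⟨d.1, hd⟩,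
    LinearMap.map_smul_of_tower, map_smul, smulk_apply]

lemma map_apply (v : IntervalModule k n a.idx j) (d : AInterval n i l)
    (hd : a.idx ≤ d.1.idx ∧ d.1.idx ≤ j) (ha : i ≤ a.idx ∧ a.idx ≤ l) :
    θ v d = v ⟨d.1, hd⟩ * θ (gen k a j) ⟨a, ha⟩ := by
  rw [map_apply_eq_pathOp_smul θ v d hd, pathOp_smul_apply hd.1, dif_pos ⟨rfl, ha.1⟩]

/-- The path from a to b acts nontrivially on the source, hence on its isomorphic image; it can do
so in M_[i,l] only if both ends lie in [i, l]. -/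
lemma bounds_of_injective {b : AVertex n} (hab : a.idx ≤ b.idx)
    (θ : IntervalModule k n a.idx b.idx →ₗ[(AlgA k n)ᵐᵒᵖ] IntervalModule k n i l)
    (hθ : Function.Injective θ) : i ≤ a.idx ∧ b.idx ≤ l := by
  have h1 : pathOp k a b • gen k a b.idx ≠ 0 := fun h0 => by
    have := pathOp_smul_gen_apply (k := k) (j := b.idx) hab ⟨hab, le_rfl⟩
    rw [h0, zero_apply] at this
    exact zero_ne_one this
  have h2 : θ (pathOp k a b • gen k a b.idx) ≠ 0 := fun h0 => h1 (hθ (h0.trans (map_zero θ).symm))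
  rw [map_smul] at h2
  by_contra hcon
  refine h2 (funext fun d => ?_)
  rw [pathOp_smul_apply hab, dif_neg, zero_apply]
  rintro ⟨rfl, hi⟩
  exact hcon ⟨hi, d.2.2⟩

lemma endo_apply (θ : IntervalModule k n a.idx j →ₗ[(AlgA k n)ᵐᵒᵖ] IntervalModule k n a.idx j)
    (ha : a.idx ≤ j) (v : IntervalModule k n a.idx j) :
    θ v = θ (gen k a j) ⟨a, le_rfl, ha⟩ • v := by
  funext d
  rw [map_apply θ v d d.2 ⟨le_rfl, ha⟩, smulk_apply, mul_comm]

lemma endo_eq_id (θ : IntervalModule k n a.idx j →ₗ[(AlgA k n)ᵐᵒᵖ] IntervalModule k n a.idx j)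
    (ha : a.idx ≤ j) (h : θ (gen k a j) ⟨a, le_rfl, ha⟩ = 1) : θ = LinearMap.id :=
  LinearMap.ext fun v => by rw [endo_apply θ ha, h, one_smul, LinearMap.id_apply]

end Map

/-- The coordinate at a vertex as a linear functional. -/
def coord {i j : ℕ} (c : AInterval n i j) : IntervalModule k n i j →ₗ[k] k where
  toFun v := v c
  map_add' _ _ := rfl
  map_smul' _ _ := rfl

lemma coord_apply {i j : ℕ} (c : AInterval n i j) (v : IntervalModule k n i j) :
    coord c v = v c := rfl

lemma inclusion_apply {i' i j : ℕ} (h : i' ≤ i) (v : IntervalModule k n i j)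
    (c : AInterval n i' j) :
    inclusion k n h j v c = if hc : i ≤ c.1.idx then v ⟨c.1, hc, c.2.2⟩ else 0 := rfl

lemma inclusion_injective {i' i j : ℕ} (h : i' ≤ i) :
    Function.Injective (inclusion k n h j) := by
  intro v w hvw
  funext c
  have := congrFun hvw ⟨c.1, h.trans c.2.1, c.2.2⟩
  rwa [inclusion_apply, inclusion_apply, dif_pos c.2.1, dif_pos c.2.1] at this

/-! ### Interval summands of arbitrary modules -/

section Module

variable {W : Type*} [AddCommGroup W] [Module (AlgA k n)ᵐᵒᵖ W] [Module k W]
  [IsScalarTower k (AlgA k n)ᵐᵒᵖ W]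

lemma ofElement_gen (a : AVertex n) {j : ℕ} (ha : a.idx ≤ j) (w : W) (hw) :
    ofElement (k := k) a j w hw (gen k a j) = pathOp k a a • w := by
  rw [ofElement_apply, Finset.sum_eq_single ⟨a, le_rfl, ha⟩]
  · rw [gen_apply_self, one_smul]
  · intro c _ hc
    rw [gen, if_neg (fun h => hc (Subtype.ext h)), zero_smul]
  · simp

/-- Every nonzero module has an interval module as a direct summand. -/
lemma exists_retract [Nontrivial W] : ∃ a b : AVertex n, a.idx ≤ b.idx ∧
    ∃ (s : IntervalModule k n a.idx b.idx →ₗ[(AlgA k n)ᵐᵒᵖ] W)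
      (r : W →ₗ[(AlgA k n)ᵐᵒᵖ] IntervalModule k n a.idx b.idx), r ∘ₗ s = LinearMap.id := by
  classical
  let S : Finset (AVertex n × AVertex n) :=
    Finset.univ.filter fun q => q.1.idx ≤ q.2.idx ∧ ∃ w : W, pathOp k q.1 q.2 • w ≠ 0
  have hS : S.Nonempty := by
    obtain ⟨w, hw⟩ := exists_ne (0 : W)
    rw [← sum_pathOp_smul (k := k) (n := n) w] at hw
    obtain ⟨a, -, ha⟩ := Finset.exists_ne_zero_of_sum_ne_zero hw
    exact ⟨(a, a), by simpa [S] using ⟨w, ha⟩⟩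
  -- A longest path acting nontrivially: every path prolonging it at either end acts as zero, which
  -- is what `ofElement` and `ofFunctional` require.
  obtain ⟨⟨a, b⟩, hq, hmax⟩ := S.exists_max_image (fun q => q.2.idx - q.1.idx) hS
  obtain ⟨hab, w, hw⟩ : a.idx ≤ b.idx ∧ ∃ w : W, pathOp k a b • w ≠ 0 := by simpa [S] using hq
  have hmax' : ∀ c d : AVertex n, c.idx ≤ d.idx → b.idx - a.idx < d.idx - c.idx →
      ∀ v : W, pathOp k c d • v = 0 := fun c d hcd hlt v => by
    by_contra hv
    exact absurd (hmax (c, d) (by simpa [S] using ⟨hcd, v, hv⟩)) (not_le.2 hlt)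
  obtain ⟨ψ, hψ⟩ : ∃ ψ : W →ₗ[k] k, ψ (pathOp k a b • w) ≠ 0 := by
    by_contra! hcon
    exact hw ((Module.forall_dual_apply_eq_zero_iff k _).1 hcon)
  refine ⟨a, b, hab, ofElement a b.idx w fun c hc hbc => hmax' a c hc (by omega) w,
    ofFunctional a.idx b ((ψ (pathOp k a b • w))⁻¹ • ψ) fun c hcb hca v => ?_, ?_⟩
  · rw [hmax' c b hcb (by omega), map_zero]
  · refine endo_eq_id _ hab ?_
    rw [LinearMap.comp_apply, ofElement_gen a hab, ofFunctional_apply,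
      pathOp_smul_smul le_rfl hab, LinearMap.smul_apply, smul_eq_mul, inv_mul_cancel₀ hψ]

end Module

/-! ### The inclusion of the radical of an interval module -/

section Inclusion

variable {a a' b : AVertex n}

lemma not_exists_inclusion_section (haa' : a'.idx = a.idx + 1) (hab : a'.idx ≤ b.idx)
    (hle : a.idx ≤ a'.idx) :
    ¬ ∃ s, inclusion k n hle b.idx ∘ₗ s = LinearMap.id := by
  rintro ⟨s, hs⟩
  have h := congrFun (LinearMap.congr_fun hs (gen k a b.idx)) ⟨a, le_rfl, by omega⟩
  rw [LinearMap.comp_apply, inclusion_apply, dif_neg (by simp [haa']), LinearMap.id_apply,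
    gen_apply_self] at h
  exact zero_ne_one h

lemma inclusion_gen (hle : a.idx ≤ a'.idx) :
    inclusion k n hle b.idx (gen k a' b.idx) = pathOp k a a' • gen k a b.idx := by
  funext c
  rw [inclusion_apply, pathOp_smul_apply hle]
  by_cases hc : a' = c.1
  · rw [dif_pos (by rw [hc]), dif_pos ⟨hc, le_rfl⟩, gen_apply_self, gen, if_pos hc.symm]
  · rw [dif_neg (fun hh : a' = c.1 ∧ a.idx ≤ a.idx => hc hh.1)]
    split_ifs
    · exact if_neg (Ne.symm hc)
    · rfl

/-- In M_[a,b] the generator of the submodule is hit by the arrow from a to a', but in M_[a',b] that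
arrow acts as zero. -/
lemma not_exists_inclusion_retraction (haa' : a'.idx = a.idx + 1) (hab : a'.idx ≤ b.idx)
    (hle : a.idx ≤ a'.idx) :
    ¬ ∃ r, r ∘ₗ inclusion k n hle b.idx = LinearMap.id := by
  rintro ⟨r, hr⟩
  have h := congrFun (LinearMap.congr_fun hr (gen k a' b.idx)) ⟨a', le_rfl, hab⟩
  rw [LinearMap.comp_apply, inclusion_gen, map_smul, pathOp_smul_apply hle,
    dif_neg (by simp [haa']), LinearMap.id_apply, gen_apply_self] at h
  exact zero_ne_one h

/-- If l ≤ a, the target vanishes at every vertex of the submodule. If a < i, the target vanishes at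
a, so the generator of M_[a,b] already goes to zero. -/
lemma comp_inclusion_eq_zero (haa' : a'.idx = a.idx + 1)
    (hle : a.idx ≤ a'.idx) {i l : ℕ} (h : l ≤ a.idx ∨ a.idx < i)
    (θ : IntervalModule k n a.idx b.idx →ₗ[(AlgA k n)ᵐᵒᵖ] IntervalModule k n i l) :
    θ ∘ₗ inclusion k n hle b.idx = 0 := by
  refine LinearMap.ext fun v => funext fun d => ?_
  rw [LinearMap.comp_apply, LinearMap.zero_apply, zero_apply]
  by_cases hd : a'.idx ≤ d.1.idx ∧ d.1.idx ≤ b.idx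
  · have := d.2
    rw [map_apply_eq_pathOp_smul θ _ d ⟨by omega, hd.2⟩, pathOp_smul_apply (by omega),
      dif_neg (by omega), mul_zero]
  · rw [← pathOp_self_smul_apply (θ _) d, ← map_smul, pathOp_self_smul_eq_zero, map_zero, zero_apply]
    intro h
    rw [inclusion_apply, dif_neg (fun hh => hd ⟨hh, h.2⟩)]

/-- In every factorization of the inclusion of `M_[a+1,b]` into `M_[a,b]`, one of the factors
splits. -/
lemma inclusion_factorization {W : Type*} [AddCommGroup W] [Module (AlgA k n)ᵐᵒᵖ W] [Module k W]
    [IsScalarTower k (AlgA k n)ᵐᵒᵖ W] (haa' : a'.idx = a.idx + 1) (hab : a'.idx ≤ b.idx)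
    (hle : a.idx ≤ a'.idx)
    (h : IntervalModule k n a'.idx b.idx →ₗ[(AlgA k n)ᵐᵒᵖ] W)
    (g : W →ₗ[(AlgA k n)ᵐᵒᵖ] IntervalModule k n a.idx b.idx)
    (hg : g ∘ₗ h = inclusion k n hle b.idx) :
    (∃ r, r ∘ₗ h = LinearMap.id) ∨ ∃ s, g ∘ₗ s = LinearMap.id := by
  have hab' := hle.trans hab
  -- Does the image of the socle vector of M_[a',b] extend back to vertex a inside W?
  by_cases hy : ∃ w, pathOp k a b • w = h (pathOp k a' b • gen k a' b.idx)
  · obtain ⟨w, hw⟩ := hy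
    -- Continuing w beyond b gives the image under h of a path leaving [a', b], hence zero. The
    -- scalar is 1 because g ∘ h is the inclusion.
    refine .inr ⟨ofElement a b.idx w fun c hac hbc => ?_, endo_eq_id _ hab' ?_⟩
    · rw [← pathOp_smul_smul hab' hbc.le, hw, ← map_smul, pathOp_smul_smul hab hbc.le]
      convert map_zero h
      funext d
      rw [pathOp_smul_apply (hab.trans hbc.le), dif_neg, zero_apply]
      rintro ⟨rfl, -⟩
      have := d.2
      omega
    · have h1 := congrFun (congrArg g hw) ⟨b, hab', le_rfl⟩
      rw [← LinearMap.comp_apply g h, hg, inclusion_apply, dif_pos hab, pathOp_smul_gen_apply hab,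
        map_smul, pathOp_smul_apply hab', dif_pos ⟨rfl, le_rfl⟩] at h1
      rw [LinearMap.comp_apply, ofElement_gen a hab', map_smul, pathOp_smul_apply le_rfl,
        dif_pos ⟨rfl, le_rfl⟩, h1]
  · let N : Submodule k W :=
      LinearMap.range (DistribSMul.toLinearMap k W (pathOp k a b : (AlgA k n)ᵐᵒᵖ))
    obtain ⟨ψ, hψ, hN⟩ := N.exists_le_ker_of_notMem hy
    -- Every path to b from a vertex before a' passes through a, so ψ kills its image.
    refine .inl ⟨ofFunctional a'.idx b ((ψ (h (pathOp k a' b • gen k a' b.idx)))⁻¹ • ψ)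
      fun c hcb hca v => ?_, endo_eq_id _ hab ?_⟩
    · rw [← pathOp_smul_smul (a := c) (b := a) (by omega) hab', LinearMap.smul_apply,
        show ψ (pathOp k a b • pathOp k c a • v) = 0 from hN ⟨_, rfl⟩, smul_zero]
    · rw [LinearMap.comp_apply, ofFunctional_apply, ← map_smul, LinearMap.smul_apply, smul_eq_mul,
        inv_mul_cancel₀ hψ]

end Inclusion

end IntervalModule

/-! ### Irreducible linear maps killed by every map to a simple module -/

namespace IntervalModule

lemma eq_zero_of_lt {i j : ℕ} (h : j < i) (v : IntervalModule k n i j) : v = 0 :=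
  funext fun c => absurd c.2 (by omega)

/-- The projection of `M_[a,b]` onto its simple top detects the coordinate at `a`. -/
lemma exists_top (k : Type u) [Field k] {a b : AVertex n} (hab : a.idx ≤ b.idx) :
    ∃ q : IntervalModule k n a.idx b.idx →ₗ[(AlgA k n)ᵐᵒᵖ] IntervalModule k n a.idx a.idx,
      ∀ v, q v ⟨a, le_rfl, le_rfl⟩ = v ⟨a, le_rfl, hab⟩ := by
  refine ⟨ofFunctional a.idx a (coord ⟨a, le_rfl, hab⟩) fun c hca hc v => ?_,
    fun v => ?_⟩
  · rw [coord_apply, pathOp_smul_apply hca, dif_neg (by omega)]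
  · rw [ofFunctional_apply, coord_apply, pathOp_self_smul_apply v ⟨a, le_rfl, hab⟩]

end IntervalModule

open IntervalModule

/-- A linear map that is neither a split monomorphism nor a split epimorphism, one of whose factors splits in every
factorization through a finitely generated module, and which is killed by every map to a simple
module. -/
structure IsIrreducibleSimpleGhost {X Y : Type u} [AddCommGroup X] [AddCommGroup Y]
    [Module (AlgA k n)ᵐᵒᵖ X] [Module (AlgA k n)ᵐᵒᵖ Y] (f : X →ₗ[(AlgA k n)ᵐᵒᵖ] Y) : Prop where
  not_retraction : ¬ ∃ r, r ∘ₗ f = LinearMap.id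
  not_section : ¬ ∃ s, f ∘ₗ s = LinearMap.id
  factor : ∀ (W : Type u) [AddCommGroup W] [Module (AlgA k n)ᵐᵒᵖ W]
    [Module.Finite (AlgA k n)ᵐᵒᵖ W] (h : X →ₗ[(AlgA k n)ᵐᵒᵖ] W) (g : W →ₗ[(AlgA k n)ᵐᵒᵖ] Y),
    g ∘ₗ h = f → (∃ r, r ∘ₗ h = LinearMap.id) ∨ ∃ s, g ∘ₗ s = LinearMap.id
  simple : ∀ (c : AVertex n) (q : Y →ₗ[(AlgA k n)ᵐᵒᵖ] IntervalModule k n c.idx c.idx), q ∘ₗ f = 0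

namespace IsIrreducibleSimpleGhost

variable {X Y : Type u} [AddCommGroup X] [AddCommGroup Y]
    [Module (AlgA k n)ᵐᵒᵖ X] [Module (AlgA k n)ᵐᵒᵖ Y] {f : X →ₗ[(AlgA k n)ᵐᵒᵖ] Y}

lemma nontrivial (hf : IsIrreducibleSimpleGhost f) : Nontrivial X := by
  by_contra h
  rw [not_nontrivial_iff_subsingleton] at h
  exact hf.not_retraction ⟨0, Subsingleton.elim _ _⟩

variable [Module k X] [IsScalarTower k (AlgA k n)ᵐᵒᵖ X] [Module.Finite (AlgA k n)ᵐᵒᵖ X]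

/-- If `T` agrees with the identity modulo maps factoring through `f`, it is bijective. -/
lemma bijective_of_add_eq (hf : IsIrreducibleSimpleGhost f) (T : X →ₗ[(AlgA k n)ᵐᵒᵖ] X)
    (u : Y →ₗ[(AlgA k n)ᵐᵒᵖ] X) (hT : ∀ x, T x + u (f x) = x) : Function.Bijective T := by
  have hsurj : Function.Surjective T := by
    rw [← LinearMap.range_eq_top]
    by_contra hne
    -- A nonzero cokernel would have a simple quotient. There x and u (f x) agree, and maps from Y
    -- to simples kill f, so X would map to it by zero.
    have : Nontrivial (X ⧸ LinearMap.range T) := Submodule.Quotient.nontrivial_iff.2 hne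
    obtain ⟨a, b, hab, s, r, hsr⟩ := exists_retract (k := k) (n := n) (W := X ⧸ LinearMap.range T)
    obtain ⟨q, hq⟩ := exists_top k hab
    obtain ⟨x, hx⟩ := Submodule.Quotient.mk_surjective _ (s (gen k a b.idx))
    have h1 : q (r (s (gen k a b.idx))) ⟨a, le_rfl, le_rfl⟩ = 1 := by
      rw [hq, ← LinearMap.comp_apply r s, hsr, LinearMap.id_apply, gen_apply_self]
    have h2 : q (r (Submodule.Quotient.mk x)) = 0 := by
      have h3 := LinearMap.congr_fun
        (hf.simple a (q ∘ₗ r ∘ₗ (LinearMap.range T).mkQ ∘ₗ u)) x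
      have h4 : (Submodule.Quotient.mk x : X ⧸ LinearMap.range T)
          = Submodule.Quotient.mk (u (f x)) := by
        rw [Submodule.Quotient.eq]
        exact ⟨x, eq_sub_of_add_eq (hT x)⟩
      rw [h4]
      exact h3
    rw [← hx, h2, IntervalModule.zero_apply] at h1
    exact zero_ne_one h1
  have : Module.Finite k (AlgA k n)ᵐᵒᵖ := Module.Finite.equiv (MulOpposite.opLinearEquiv k)
  have : Module.Finite k X := Module.Finite.trans (AlgA k n)ᵐᵒᵖ X
  exact ⟨(LinearMap.injective_iff_surjective (f := T.restrictScalars k)).2 hsurj, hsurj⟩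

variable [Module k Y] [IsScalarTower k (AlgA k n)ᵐᵒᵖ Y] [Module.Finite (AlgA k n)ᵐᵒᵖ Y]

lemma exists_equiv (hf : IsIrreducibleSimpleGhost f) {a b : AVertex n} (hab : a.idx ≤ b.idx)
    (s : IntervalModule k n a.idx b.idx →ₗ[(AlgA k n)ᵐᵒᵖ] Y)
    (p : Y →ₗ[(AlgA k n)ᵐᵒᵖ] IntervalModule k n a.idx b.idx) (hps : p ∘ₗ s = LinearMap.id) :
    a.idx < b.idx ∧
      ∃ h : X ≃ₗ[(AlgA k n)ᵐᵒᵖ] IntervalModule k n (a.idx + 1) b.idx,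
        ∀ x, p (f x) = inclusion k n (Nat.le_succ a.idx) b.idx (h x) := by
  have hps' : ∀ v, p (s v) = v := LinearMap.congr_fun hps
  have htop : ∀ x, p (f x) ⟨a, le_rfl, hab⟩ = 0 := fun x => by
    obtain ⟨q, hq⟩ := exists_top k hab
    rw [← hq (p (f x))]
    exact congrFun (LinearMap.congr_fun (hf.simple a (q ∘ₗ p)) x) _
  let h : X →ₗ[(AlgA k n)ᵐᵒᵖ] IntervalModule k n (a.idx + 1) b.idx :=
    ofFunctional (a.idx + 1) b
      (coord (k := k) ⟨b, hab, le_rfl⟩ ∘ₗ p.restrictScalars k ∘ₗ f.restrictScalars k)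
      fun c hcb hca x => by
        simp only [LinearMap.comp_apply, LinearMap.restrictScalars_apply, map_smul, coord_apply]
        rw [pathOp_smul_apply hcb]
        split_ifs with hc
        · obtain rfl : c = a := AVertex.ext (by omega)
          exact htop x
        · rfl
  have hh : ∀ x, p (f x) = inclusion k n (Nat.le_succ a.idx) b.idx (h x) := fun x => by
    funext d
    have hd := d.2
    rw [inclusion_apply]
    split_ifs with hc
    · simp only [h, ofFunctional_apply, LinearMap.comp_apply, LinearMap.restrictScalars_apply,
        map_smul, coord_apply]
      rw [pathOp_smul_apply hd.2, dif_pos ⟨rfl, hd.1⟩]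
    · obtain ⟨d, hd'⟩ := d
      obtain rfl : d = a := AVertex.ext (by simp only at hd hc; omega)
      exact htop x
  -- Replace the summand M_[a,b] of Y by its radical: f = s p f + (1 - s p) f. The composite p ∘ G
  -- never reaches vertex a, so G has no section and H must split.
  let H : X →ₗ[(AlgA k n)ᵐᵒᵖ] IntervalModule k n (a.idx + 1) b.idx × Y :=
    h.prod (f - s ∘ₗ p ∘ₗ f)
  let G : IntervalModule k n (a.idx + 1) b.idx × Y →ₗ[(AlgA k n)ᵐᵒᵖ] Y :=
    (s ∘ₗ inclusion k n (Nat.le_succ a.idx) b.idx).coprod (LinearMap.id - s ∘ₗ p)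
  have hGH : G ∘ₗ H = f := by
    ext x
    simp [G, H, ← hh, hps']
  have hex : ∃ r, r ∘ₗ H = LinearMap.id := by
    refine (hf.factor _ H G hGH).resolve_right ?_
    rintro ⟨σ, hσ⟩
    have h1 : p (G (σ (s (gen k a b.idx)))) = gen k a b.idx := by
      rw [← LinearMap.comp_apply G σ, hσ, LinearMap.id_apply, hps']
    have h2 := congrFun h1 ⟨a, le_rfl, hab⟩
    simp only [G, LinearMap.coprod_apply, map_add, LinearMap.comp_apply, LinearMap.sub_apply,
      LinearMap.id_apply, map_sub, hps', sub_self, add_zero] at h2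
    rw [inclusion_apply, dif_neg (by simp), gen_apply_self] at h2
    exact zero_ne_one h2
  obtain ⟨r, hr⟩ := hex
  let r₁ : IntervalModule k n (a.idx + 1) b.idx →ₗ[(AlgA k n)ᵐᵒᵖ] X :=
    r ∘ₗ LinearMap.inl _ _ _
  -- The Y-component of r ∘ H = 1 factors through f, so r₁ ∘ h is the identity up to such a map.
  have hT := hf.bijective_of_add_eq (r₁ ∘ₗ h) (r ∘ₗ LinearMap.inr _ _ _ ∘ₗ (LinearMap.id - s ∘ₗ p))
    fun x => by
      conv_rhs => rw [← LinearMap.id_apply (R := (AlgA k n)ᵐᵒᵖ) x, ← hr]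
      simp only [r₁, H, LinearMap.comp_apply, LinearMap.prod_apply, Function.prod,
        LinearMap.inl_apply, LinearMap.inr_apply, ← map_add, Prod.mk_add_mk, add_zero, zero_add,
        LinearMap.sub_apply, LinearMap.id_apply]
  have hinj : Function.Injective h :=
    Function.Injective.of_comp (f := r₁) hT.1
  have := hf.nontrivial
  obtain ⟨x, hx⟩ := exists_ne (0 : X)
  have hlt : a.idx < b.idx := by
    by_contra hlt
    exact hx (hinj ((eq_zero_of_lt (by omega) _).trans (eq_zero_of_lt (by omega) _).symm))
  refine ⟨hlt, LinearEquiv.ofBijective h ⟨hinj, fun v => ?_⟩, hh⟩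
  have hb := b.le_n
  -- Endomorphisms of an interval module are scalars; a nonzero scalar makes h surjective.
  obtain ⟨y, hy⟩ : ∃ c : k, ∀ v, h (r₁ v) = c • v :=
    ⟨_, endo_apply (a := ⟨a.idx + 1, by omega, by omega⟩) (h ∘ₗ r₁) hlt⟩
  have hy0 : y ≠ 0 := by
    rintro rfl
    refine hx (hT.1 (hinj ?_))
    rw [LinearMap.comp_apply, hy, zero_smul, map_zero, map_zero]
  exact ⟨r₁ (y⁻¹ • v), by rw [hy, smul_smul, mul_inv_cancel₀ hy0, one_smul]⟩

/-- Up to isomorphism, `f` is the inclusion of `M_[a+1,b]` into `M_[a,b]`. -/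
theorem exists_equiv_inclusion (hf : IsIrreducibleSimpleGhost f) : ∃ a b : AVertex n,
    a.idx < b.idx ∧ ∃ (h : X ≃ₗ[(AlgA k n)ᵐᵒᵖ] IntervalModule k n (a.idx + 1) b.idx)
      (p : Y ≃ₗ[(AlgA k n)ᵐᵒᵖ] IntervalModule k n a.idx b.idx),
        ∀ x, p (f x) = inclusion k n (Nat.le_succ a.idx) b.idx (h x) := by
  have := hf.nontrivial
  have hY : Nontrivial Y := by
    by_contra hY
    rw [not_nontrivial_iff_subsingleton] at hY
    exact hf.not_section ⟨0, Subsingleton.elim _ _⟩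
  obtain ⟨a, b, hab, s, p, hps⟩ := exists_retract (k := k) (n := n) (W := Y)
  have hps' : ∀ v, p (s v) = v := LinearMap.congr_fun hps
  obtain ⟨hlt, h, hh⟩ := hf.exists_equiv hab s p hps
  refine ⟨a, b, hlt, h, LinearEquiv.ofBijective p ⟨?_, fun v => ⟨s v, hps' v⟩⟩, hh⟩
  rw [← LinearMap.ker_eq_bot]
  by_contra hker
  have : Nontrivial (LinearMap.ker p) := Submodule.nontrivial_iff_ne_bot.2 hker
  obtain ⟨a₁, b₁, hab₁, s₁, r₁, hrs₁⟩ := exists_retract (k := k) (n := n) (W := LinearMap.ker p)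
  let e : Y →ₗ[(AlgA k n)ᵐᵒᵖ] LinearMap.ker p :=
    (LinearMap.id - s ∘ₗ p).codRestrict _ fun y => by simp [hps']
  have he : ∀ z : LinearMap.ker p, e z = z := fun z => Subtype.ext (by simp [e])
  have hs' : (r₁ ∘ₗ e) ∘ₗ ((LinearMap.ker p).subtype ∘ₗ s₁) = LinearMap.id := by
    ext v
    simpa [he] using LinearMap.congr_fun hrs₁ v
  obtain ⟨hlt₁, h₁, hh₁⟩ := hf.exists_equiv hab₁ _ _ hs'
  have hb := b.le_n
  have hb₁ := b₁.le_n
  let E := h.symm.trans h₁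
  -- Both radicals are isomorphic to X; the bounds in the two directions force equal endpoints.
  have hE := bounds_of_injective (a := ⟨a.idx + 1, by omega, by omega⟩) hlt E.toLinearMap
    E.injective
  have hE' := bounds_of_injective (a := ⟨a₁.idx + 1, by omega, by omega⟩) hlt₁
    E.symm.toLinearMap E.symm.injective
  obtain rfl : a₁ = a := AVertex.ext (by simp only at hE hE'; omega)
  obtain rfl : b₁ = b := AVertex.ext (by omega)
  obtain ⟨c, hc⟩ : ∃ c : k, ∀ v, E v = c • v :=
    ⟨_, endo_apply (a := ⟨a₁.idx + 1, by omega, by omega⟩) E.toLinearMap hlt⟩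
  have hps₁ : ∀ v, p (s₁ v) = 0 := fun v => (s₁ v).2
  -- Since p kills the second summand, subtracting c • p keeps a projection onto it. By the choice
  -- of c this projection kills f, yet `exists_equiv` makes its composite with f injective.
  obtain ⟨-, h₂, hh₂⟩ := hf.exists_equiv hab ((LinearMap.ker p).subtype ∘ₗ s₁)
    (r₁ ∘ₗ e - c • p) (by rw [LinearMap.sub_comp, hs']; ext v; simp [hps₁])
  obtain ⟨x, hx⟩ := exists_ne (0 : X)
  refine hx (h₂.injective (inclusion_injective (Nat.le_succ a₁.idx) ?_))
  have h₁x : h₁ x = c • h x := by rw [← hc]; simp [E]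
  rw [← hh₂, LinearMap.sub_apply, hh₁, h₁x, LinearMap.map_smul_of_tower, LinearMap.smul_apply, hh,
    sub_self, map_zero, map_zero]

end IsIrreducibleSimpleGhost

/-! ### Split and irreducible morphisms in categories of finitely generated modules -/

section Category

universe v w

variable {C : Type w} [Category.{v} C]

lemma IsIrreducibleMor.of_arrow_iso {X Y X' Y' : C} {f : X ⟶ Y} {f' : X' ⟶ Y'}
    (e : Arrow.mk f ≅ Arrow.mk f') (hf : IsIrreducibleMor f') : IsIrreducibleMor f := by
  let α : X ≅ X' := Arrow.leftFunc.mapIso e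
  let β : Y ≅ Y' := Arrow.rightFunc.mapIso e
  have hw : α.hom ≫ f' = f ≫ β.hom := e.hom.w
  have hf' : f' = α.inv ≫ f ≫ β.hom := by rw [← hw, Iso.inv_hom_id_assoc]
  obtain ⟨h1, h2, h3⟩ := hf
  refine ⟨fun h => h1 (by rw [hf']; infer_instance), fun h => h2 (by rw [hf']; infer_instance),
    fun W h g hg => ?_⟩
  rcases h3 W (α.inv ≫ h) (g ≫ β.hom) (by rw [hf', ← hg]; simp) with h' | h'
  · left
    have := (inferInstance : IsSplitMono (α.hom ≫ α.inv ≫ h))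
    rwa [Iso.hom_inv_id_assoc] at this
  · right
    have := (inferInstance : IsSplitEpi ((g ≫ β.hom) ≫ β.inv))
    rwa [Category.assoc, Iso.hom_inv_id, Category.comp_id] at this

variable [Preadditive C]

lemma IsCoghost.of_arrow_iso {T X Y X' Y' : C} {f : X ⟶ Y} {f' : X' ⟶ Y'}
    (e : Arrow.mk f ≅ Arrow.mk f') (hf : IsCoghost T f') : IsCoghost T f := by
  let α : X ≅ X' := Arrow.leftFunc.mapIso e
  let β : Y ≅ Y' := Arrow.rightFunc.mapIso e
  have hw : α.hom ≫ f' = f ≫ β.hom := e.hom.w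
  have hf' : f = α.hom ≫ f' ≫ β.inv := by rw [← Category.assoc, hw]; simp
  intro T' hT' g
  rw [hf', Category.assoc, Category.assoc, hf T' hT' (β.inv ≫ g), Limits.comp_zero]

lemma InAdd.of_retract {T T' : C} (h : Retract T' T) : InAdd T T' :=
  ⟨1, (Limits.limitBiconeOfUnique fun _ : Fin 1 => T).bicone,
    ⟨(Limits.limitBiconeOfUnique fun _ : Fin 1 => T).isBilimit⟩, ⟨h⟩⟩

/-- A map into a summand of a power of T is determined by its components in the copies of T. -/
lemma isCoghost_of_forall {T X Y : C} {f : X ⟶ Y} (h : ∀ g : Y ⟶ T, f ≫ g = 0) :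
    IsCoghost T f := by
  rintro T' ⟨r, B, ⟨hB⟩, ⟨ρ⟩⟩ g
  have h0 : f ≫ g ≫ ρ.i = 0 := hB.isLimit.hom_ext fun j => by
    simpa using h (g ≫ ρ.i ≫ B.toCone.π.app j)
  rw [← Category.comp_id g, ← ρ.retract, ← Category.assoc g, ← Category.assoc, h0,
    Limits.zero_comp]

end Category

section FGModule

variable {R : Type u} [Ring R] {X Y : FGModuleCat.{u} R}

lemma FGModuleCat.isSplitMono_iff (f : X ⟶ Y) :
    IsSplitMono f ↔ ∃ r : Y →ₗ[R] X, r ∘ₗ f.hom.hom = LinearMap.id := by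
  constructor
  · intro h
    exact ⟨(retraction f).hom.hom, congrArg (fun g : X ⟶ X => g.hom.hom) (IsSplitMono.id f)⟩
  · rintro ⟨r, hr⟩
    exact .mk' ⟨FGModuleCat.ofHom r, FGModuleCat.hom_ext hr⟩

lemma FGModuleCat.isSplitEpi_iff (f : X ⟶ Y) :
    IsSplitEpi f ↔ ∃ s : Y →ₗ[R] X, f.hom.hom ∘ₗ s = LinearMap.id := by
  constructor
  · intro h
    exact ⟨(section_ f).hom.hom, congrArg (fun g : Y ⟶ Y => g.hom.hom) (IsSplitEpi.id f)⟩
  · rintro ⟨s, hs⟩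
    exact .mk' ⟨FGModuleCat.ofHom s, FGModuleCat.hom_ext hs⟩

end FGModule

/-! ### The coghosts -/

lemma isIrreducibleMor_fPlus {i j : ℕ} (hi : 2 ≤ i) (hij : i ≤ j) (hj : j ≤ n) :
    IsIrreducibleMor (fPlus k n i j) := by
  let a : AVertex n := ⟨i - 1, by omega, by omega⟩
  let a' : AVertex n := ⟨i, by omega, by omega⟩
  let b : AVertex n := ⟨j, by omega, hj⟩
  have haa' : a'.idx = a.idx + 1 := by simp only [a, a']; omega
  refine ⟨fun h => ?_, fun h => ?_, fun W h g hg => ?_⟩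
  · exact not_exists_inclusion_retraction (k := k) (b := b) haa' hij (Nat.sub_le i 1)
      ((FGModuleCat.isSplitMono_iff _).1 h)
  · exact not_exists_inclusion_section (k := k) (b := b) haa' hij (Nat.sub_le i 1)
      ((FGModuleCat.isSplitEpi_iff _).1 h)
  · rw [FGModuleCat.isSplitMono_iff, FGModuleCat.isSplitEpi_iff]
    -- Objects carry only the action of the algebra; the k-structure is restored through its
    -- scalars.
    let _ : Module k W := Module.compHom W (algebraMap k (AlgA k n)ᵐᵒᵖ)
    have : IsScalarTower k (AlgA k n)ᵐᵒᵖ W :=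
      ⟨fun r x v => by rw [Algebra.smul_def, mul_smul]; rfl⟩
    exact inclusion_factorization (k := k) (b := b) haa' hij (Nat.sub_le i 1) h.hom.hom g.hom.hom
      (congrArg (fun f : intervalObj k n i j ⟶ intervalObj k n (i - 1) j => f.hom.hom) hg)

lemma isCoghost_fPlus {m i j : ℕ} (hi : m + 1 ≤ i) (hi' : 2 ≤ i) (hij : i ≤ j) (hj : j ≤ n) :
    IsCoghost (Tm k n m) (fPlus k n i j) := by
  let a : AVertex n := ⟨i - 1, by omega, by omega⟩
  let a' : AVertex n := ⟨i, by omega, by omega⟩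
  let b : AVertex n := ⟨j, by omega, hj⟩
  have haa' : a'.idx = a.idx + 1 := by simp only [a, a']; omega
  refine isCoghost_of_forall fun g => FGModuleCat.hom_ext (LinearMap.ext fun v => ?_)
  let θ : IntervalModule k n a.idx b.idx →ₗ[(AlgA k n)ᵐᵒᵖ]
    ((∀ j : Finset.Icc 1 m, IntervalModule k n 1 j) ×
      (∀ i : Finset.Icc 1 n, IntervalModule k n i i)) := g.hom.hom
  refine Prod.ext (funext fun l => ?_) (funext fun c => ?_)
  · have hl := Finset.mem_Icc.1 l.2
    exact LinearMap.congr_fun (comp_inclusion_eq_zero (b := b) haa' (Nat.sub_le i 1)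
      (.inl (by simp only [a]; omega)) (LinearMap.proj l ∘ₗ LinearMap.fst _ _ _ ∘ₗ θ)) v
  · exact LinearMap.congr_fun (comp_inclusion_eq_zero (b := b) haa' (Nat.sub_le i 1)
      (le_or_gt _ _) (LinearMap.proj c ∘ₗ LinearMap.snd _ _ _ ∘ₗ θ)) v

lemma inAdd_Tm_one {m l : ℕ} (hl : 1 ≤ l ∧ l ≤ m) : InAdd (Tm k n m) (intervalObj k n 1 l) := by
  let l' : Finset.Icc 1 m := ⟨l, Finset.mem_Icc.2 hl⟩
  refine .of_retract ⟨FGModuleCat.ofHom (LinearMap.inl _ _ _ ∘ₗ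
    LinearMap.single (AlgA k n)ᵐᵒᵖ (fun j : Finset.Icc 1 m => IntervalModule k n 1 j) l'),
    FGModuleCat.ofHom ((LinearMap.proj l' :
      (∀ j : Finset.Icc 1 m, IntervalModule k n 1 j) →ₗ[(AlgA k n)ᵐᵒᵖ] _) ∘ₗ LinearMap.fst _ _ _),
    FGModuleCat.hom_ext (LinearMap.ext fun v => ?_)⟩
  exact Pi.single_eq_same (M := fun j : Finset.Icc 1 m => IntervalModule k n 1 j) l' v

lemma inAdd_Tm_simple {m c : ℕ} (hc : 1 ≤ c ∧ c ≤ n) :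
    InAdd (Tm k n m) (intervalObj k n c c) := by
  let c' : Finset.Icc 1 n := ⟨c, Finset.mem_Icc.2 hc⟩
  refine .of_retract ⟨FGModuleCat.ofHom (LinearMap.inr _ _ _ ∘ₗ
    LinearMap.single (AlgA k n)ᵐᵒᵖ (fun i : Finset.Icc 1 n => IntervalModule k n i i) c'),
    FGModuleCat.ofHom ((LinearMap.proj c' :
      (∀ i : Finset.Icc 1 n, IntervalModule k n i i) →ₗ[(AlgA k n)ᵐᵒᵖ] _) ∘ₗ LinearMap.snd _ _ _),
    FGModuleCat.hom_ext (LinearMap.ext fun v => ?_)⟩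
  exact Pi.single_eq_same (M := fun i : Finset.Icc 1 n => IntervalModule k n i i) c' v

lemma isIrreducibleSimpleGhost {m : ℕ} {X Y : ModA k n} {f : X ⟶ Y} (hf : IsIrreducibleMor f)
    (hT : IsCoghost (Tm k n m) f) : IsIrreducibleSimpleGhost f.hom.hom where
  not_retraction := fun h => hf.1 ((FGModuleCat.isSplitMono_iff f).2 h)
  not_section := fun h => hf.2.1 ((FGModuleCat.isSplitEpi_iff f).2 h)
  factor W _ _ _ h g hg := by
    have := hf.2.2 (FGModuleCat.of _ W) (FGModuleCat.ofHom h) (FGModuleCat.ofHom g)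
      (FGModuleCat.hom_ext hg)
    rwa [FGModuleCat.isSplitMono_iff, FGModuleCat.isSplitEpi_iff] at this
  simple c q := congrArg (fun g : X ⟶ intervalObj k n c.idx c.idx => g.hom.hom)
    (hT _ (inAdd_Tm_simple ⟨c.one_le, c.le_n⟩) (FGModuleCat.ofHom q))

lemma exists_arrow_iso_fPlus {m : ℕ} {X Y : ModA k n} {f : X ⟶ Y} (hf : IsIrreducibleMor f)
    (hT : IsCoghost (Tm k n m) f) : ∃ i j : ℕ, m + 1 ≤ i ∧ i ≤ j ∧ j ≤ n ∧
      Nonempty (Arrow.mk f ≅ Arrow.mk (fPlus k n i j)) := by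
  let _ : Module k X := Module.compHom X (algebraMap k (AlgA k n)ᵐᵒᵖ)
  have : IsScalarTower k (AlgA k n)ᵐᵒᵖ X :=
    ⟨fun r x v => by rw [Algebra.smul_def, mul_smul]; rfl⟩
  let _ : Module k Y := Module.compHom Y (algebraMap k (AlgA k n)ᵐᵒᵖ)
  have : IsScalarTower k (AlgA k n)ᵐᵒᵖ Y :=
    ⟨fun r x v => by rw [Algebra.smul_def, mul_smul]; rfl⟩
  obtain ⟨a, b, hab, h, p, hp⟩ := (isIrreducibleSimpleGhost hf hT).exists_equiv_inclusion
  have hb := b.le_n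
  refine ⟨a.idx + 1, b.idx, ?_, hab, hb, ⟨Arrow.isoMk h.toFGModuleCatIso p.toFGModuleCatIso
    (FGModuleCat.hom_ext (LinearMap.ext fun x => (hp x).symm))⟩⟩
  by_contra hm
  -- If a + 1 ≤ m, then M_[1,a+1] lies in add T_m. The map q, reading the coordinate at a + 1, does
  -- not kill the generator of the submodule.
  let c : AVertex n := ⟨a.idx + 1, by omega, by omega⟩
  have hc : a.idx ≤ c.idx ∧ c.idx ≤ b.idx := ⟨Nat.le_succ _, hab⟩
  let q : IntervalModule k n a.idx b.idx →ₗ[(AlgA k n)ᵐᵒᵖ] IntervalModule k n 1 c.idx :=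
    ofFunctional 1 c (coord ⟨c, hc⟩) fun d _ hd => absurd d.one_le (by omega)
  obtain ⟨x, hx⟩ := h.surjective (gen k c b.idx)
  have h0 : q (p (f.hom.hom x)) = 0 := LinearMap.congr_fun (congrArg
    (fun g : X ⟶ intervalObj k n 1 c.idx => g.hom.hom)
    (hT _ (inAdd_Tm_one (l := c.idx) ⟨c.one_le, by simp only [c]; omega⟩)
      (FGModuleCat.ofHom (q ∘ₗ p.toLinearMap)))) x
  have h1 := congrFun h0 ⟨c, c.one_le, le_rfl⟩
  rw [hp, hx, ofFunctional_apply, coord_apply, pathOp_self_smul_apply _ ⟨c, hc⟩, inclusion_apply,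
    dif_pos le_rfl, gen_apply_self] at h1
  exact one_ne_zero h1

end

theorem proposition4 (k : Type u) [Field k] (n m : ℕ) (hm : 1 ≤ m) (hmn : m < n) :
    (∀ i t : ℕ, m + 1 ≤ i → i + t ≤ n → Mono (fPlus k n i (n - t))) ∧
    ∀ (X Y : ModA k n) (f : X ⟶ Y),
      (IsIrreducibleMor f ∧ IsCoghost (Tm k n m) f) ↔
        ∃ i t : ℕ, m + 1 ≤ i ∧ i + t ≤ n ∧
          Nonempty (Arrow.mk f ≅ Arrow.mk (fPlus k n i (n - t))) := by
  refine ⟨fun i t _ _ => ConcreteCategory.mono_of_injective _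
    (IntervalModule.inclusion_injective (Nat.sub_le i 1)), fun X Y f => ⟨?_, ?_⟩⟩
  · rintro ⟨hf, hT⟩
    obtain ⟨i, j, hi, hij, hj, e⟩ := exists_arrow_iso_fPlus hf hT
    refine ⟨i, n - j, hi, by omega, ?_⟩
    rwa [Nat.sub_sub_self hj]
  · rintro ⟨i, t, hi, hit, ⟨e⟩⟩
    -- Here m ≥ 1 gives i ≥ 2, so i - 1 is a genuine vertex.
    exact ⟨(isIrreducibleMor_fPlus (by omega) (by omega) (Nat.sub_le n t)).of_arrow_iso e,
      (isCoghost_fPlus hi (by omega) (by omega) (Nat.sub_le n t)).of_arrow_iso e⟩
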